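/- For a finite graph $G$ and an integer $j \ge 0$, let $\mathsf{TJ}_j(G)$ be the graph whose vertices are the cliques of $G$ of size $j$, where two cliques $C, C'$ are adjacent if $C \setminus C' = \{u\}$ and $C' \setminus C = \{v\}$ for some $u, v \in V(G)$; let $\mathsf{TS}_j(G)$ be the graph on the same vertices, where $C, C'$ are adjacent if in addition $uv \in E(G)$. For a graph $H$ and an integer $c \ge 0$, let $H + cK_1$ be the graph obtained from $H$ by adding $c$ isolated vertices, and let $\omega(G)$ be the clique number of $G$. There are an algorithm (a program of a unit-cost random access machine with addition and truncated subtraction) and a polynomial $p$ such that the following holds. Let $G$ be any finite non-empty simple graph, let $k = \omega(G)$, and let $T$ be any graph on $\{0, \dots, N-1\}$ that is isomorphic to $\mathsf{TJ}_k(G)$ (so $\mathsf{TJ}_k(G)$ is given as an unlabelled graph, without the cliques of $G$ that its vertices stand for). On input $k$ and the adjacency matrix of $T$, the algorithm halts after at most $k^2 \cdot p(N)$ steps and outputs the adjacency matrix of a graph $H$ with $$\mathsf{TS}_{k-1}(G) \cong H + cK_1 \quad\text{for some integer } c \ge 0.$$ -/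

import Mathlib

/-! ### Reconfiguration graphs of cliques -/

/-- The graph `TJ_k(G)`: its vertices are the cliques of `G` of size `k`, and two of them are
adjacent if one arises from the other by exchanging one vertex `u` for another vertex `v`. -/
def TJGraph {V : Type*} (k : ℕ) (G : SimpleGraph V) :
    SimpleGraph {C : Finset V // G.IsNClique k C} where
  Adj C D := ∃ u v : V, (C.1 : Set V) \ (D.1 : Set V) = {u} ∧ (D.1 : Set V) \ (C.1 : Set V) = {v}
  symm := ⟨fun _ _ ⟨u, v, h, h'⟩ => ⟨v, u, h', h⟩⟩
  loopless := ⟨fun C ⟨u, _, h, _⟩ => by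
    rw [Set.sdiff_self] at h
    exact Set.singleton_ne_empty u h.symm⟩

/-- The graph `TS_k(G)`: its vertices are the cliques of `G` of size `k`, and two of them are
adjacent if one arises from the other by exchanging one vertex `u` for a vertex `v` that is
adjacent to `u` in `G`. -/
def TSGraph {V : Type*} (k : ℕ) (G : SimpleGraph V) :
    SimpleGraph {C : Finset V // G.IsNClique k C} where
  Adj C D := ∃ u v : V, (C.1 : Set V) \ (D.1 : Set V) = {u} ∧
    (D.1 : Set V) \ (C.1 : Set V) = {v} ∧ G.Adj u v
  symm := ⟨fun _ _ ⟨u, v, h, h', huv⟩ => ⟨v, u, h', h, huv.symm⟩⟩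
  loopless := ⟨fun C ⟨u, _, h, _⟩ => by
    rw [Set.sdiff_self] at h
    exact Set.singleton_ne_empty u h.symm⟩

/-! ### Random access machines

Programs for a unit-cost random access machine with addition and truncated subtraction, in
structured form. A program text mentions only finitely many registers and arrays; registers and
array cells hold natural numbers. -/

namespace RAM

/-- The memory: registers `reg x` and arrays `arr a`, where `arr a i` is cell `i` of array `a`. -/
structure Memory where
  reg : ℕ → ℕ
  arr : ℕ → ℕ → ℕ

/-- Write `v` into register `x`. -/
def Memory.setReg (σ : Memory) (x v : ℕ) : Memory where
  reg := Function.update σ.reg x v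
  arr := σ.arr

/-- Write `v` into cell `i` of array `a`. -/
def Memory.setCell (σ : Memory) (a i v : ℕ) : Memory where
  reg := σ.reg
  arr := Function.update σ.arr a (Function.update (σ.arr a) i v)

/-- Expressions: constants, registers, array cells `a[e]`, sums and truncated differences. -/
inductive Expr where
  | lit (n : ℕ)
  | reg (x : ℕ)
  | cell (a : ℕ) (e : Expr)
  | plus (e f : Expr)
  | minus (e f : Expr)

/-- The value of an expression. -/
def Expr.eval (σ : Memory) : Expr → ℕ
  | .lit n => n
  | .reg x => σ.reg x
  | .cell a e => σ.arr a (e.eval σ)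
  | .plus e f => e.eval σ + f.eval σ
  | .minus e f => e.eval σ - f.eval σ

/-- The cost of evaluating an expression: one step for each constant, register access, array
access and arithmetic operation. -/
def Expr.cost : Expr → ℕ
  | .lit _ => 1
  | .reg _ => 1
  | .cell _ e => e.cost + 1
  | .plus e f => e.cost + f.cost + 1
  | .minus e f => e.cost + f.cost + 1

/-- Programs: no operation, assignment `x := e` to a register, assignment `a[e] := f` to an array
cell, sequential composition, branching on `e ≠ 0`, and the loop `while e ≠ 0`. -/
inductive Program where
  | skip
  | assign (x : ℕ) (e : Expr)
  | store (a : ℕ) (e f : Expr)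
  | seq (P Q : Program)
  | ite (e : Expr) (P Q : Program)
  | while (e : Expr) (P : Program)

/-- `Exec P σ τ t`: started in memory `σ`, the program `P` halts in memory `τ` after exactly `t`
steps. Each executed instruction, and each test of a branch or loop condition, costs one step in
addition to the cost of the expressions that it evaluates. -/
inductive Exec : Program → Memory → Memory → ℕ → Prop where
  | skip (σ : Memory) : Exec .skip σ σ 1
  | assign (x : ℕ) (e : Expr) (σ : Memory) :
      Exec (.assign x e) σ (σ.setReg x (e.eval σ)) (e.cost + 1)
  | store (a : ℕ) (e f : Expr) (σ : Memory) :
      Exec (.store a e f) σ (σ.setCell a (e.eval σ) (f.eval σ)) (e.cost + f.cost + 1)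
  | seq {P Q : Program} {σ τ ρ : Memory} {s t : ℕ} :
      Exec P σ τ s → Exec Q τ ρ t → Exec (.seq P Q) σ ρ (s + t)
  | ite_true {e : Expr} {P Q : Program} {σ τ : Memory} {t : ℕ} :
      e.eval σ ≠ 0 → Exec P σ τ t → Exec (.ite e P Q) σ τ (e.cost + 1 + t)
  | ite_false {e : Expr} {P Q : Program} {σ τ : Memory} {t : ℕ} :
      e.eval σ = 0 → Exec Q σ τ t → Exec (.ite e P Q) σ τ (e.cost + 1 + t)
  | while_true {e : Expr} {P : Program} {σ τ ρ : Memory} {s t : ℕ} :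
      e.eval σ ≠ 0 → Exec P σ τ s → Exec (.while e P) τ ρ t →
        Exec (.while e P) σ ρ (e.cost + 1 + s + t)
  | while_false {e : Expr} {P : Program} {σ : Memory} :
      e.eval σ = 0 → Exec (.while e P) σ σ (e.cost + 1)

open Classical in
/-- The adjacency matrix of a graph on `Fin n`, row by row: cell `i * n + j` is `1` if `i` and `j`
are adjacent, and all other cells are `0`. -/
noncomputable def adjArray {n : ℕ} (T : SimpleGraph (Fin n)) : ℕ → ℕ :=
  fun x => if ∃ i j : Fin n, x = i.1 * n + j.1 ∧ T.Adj i j then 1 else 0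

/-- The memory that holds the input `(T, k)`: register `0` holds the number of vertices of `T`,
register `1` holds `k`, array `0` holds the adjacency matrix of `T`, and everything else is `0`. -/
noncomputable def inputMemory {n : ℕ} (T : SimpleGraph (Fin n)) (k : ℕ) : Memory where
  reg := fun x => if x = 0 then n else if x = 1 then k else 0
  arr := fun a => if a = 0 then adjArray T else fun _ => 0

/-- The memory `σ` holds the output `H`: register `0` holds the number `m` of vertices of `H`, and
the first `m * m` cells of array `1` hold the adjacency matrix of `H`. -/
def HoldsOutput (σ : Memory) {m : ℕ} (H : SimpleGraph (Fin m)) : Prop :=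
  σ.reg 0 = m ∧ ∀ x < m * m, σ.arr 1 x = adjArray H x

end RAM

/-! Call a (k-1)-clique a facet if it lies in a k-clique, and let its star be the set of k-cliques
containing it. Two (k-1)-cliques are adjacent in `TSGraph` exactly if they are distinct and lie in a
common k-clique (`TSGraph_adj_iff`). Hence non-facets are isolated, and on facets `TSGraph` is the
intersection graph of the stars. It remains to recover the family of stars, with multiplicities,
from the unlabelled graph T and k.

Adjacent k-cliques share exactly one facet, their intersection. Since k is the clique number, three
pairwise adjacent k-cliques share the same facet (`inter_subset_of_TJGraph_adj`); otherwise there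
would be a (k+1)-clique. So the star of the facet shared by C and D consists of C, D and their
common neighbours. Each k-clique has k facets, so the star {C} occurs k minus the number of larger
stars through C times.

`IsGeometry` abstracts these properties, `isGeometry_facetStar` proves them, and
`IsGeometry.exists_equiv` shows that the list `rows`, defined from adjacency and k alone, is the
family of stars. A larger star is listed once, from its two smallest elements C < D. For the
multiplicity of {C}, the larger stars through C are counted by their smallest element other than C,
which may lie below C.

The program tabulates `rows` as an incidence matrix of at most kN rows of length N, and then tests
all pairs of rows for intersection in O(k²N³) steps. -/

namespace RAM

/-! ### Program logic: total correctness with time bounds. -/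

@[simp] theorem Memory.setReg_reg (σ : Memory) (x v y : ℕ) :
    (σ.setReg x v).reg y = if y = x then v else σ.reg y := by
  simp [Memory.setReg, Function.update_apply]

@[simp] theorem Memory.setReg_arr (σ : Memory) (x v : ℕ) : (σ.setReg x v).arr = σ.arr := rfl

@[simp] theorem Memory.setCell_reg (σ : Memory) (a i v : ℕ) : (σ.setCell a i v).reg = σ.reg := rfl

theorem Memory.setCell_arr_self (σ : Memory) (a i v : ℕ) :
    (σ.setCell a i v).arr a = Function.update (σ.arr a) i v := by
  simp [Memory.setCell]

theorem Memory.setCell_arr_of_ne (σ : Memory) {a b : ℕ} (i v : ℕ) (h : b ≠ a) :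
    (σ.setCell a i v).arr b = σ.arr b := by
  simp [Memory.setCell, Function.update_of_ne h]

attribute [simp] Expr.eval Expr.cost

/-- Total correctness with a time bound: started in `σ`, the program `P` halts after at most `T`
steps in a memory that satisfies `Q`. -/
def Runs (P : Program) (T : ℕ) (σ : Memory) (Q : Memory → Prop) : Prop :=
  ∃ τ t, Exec P σ τ t ∧ t ≤ T ∧ Q τ

variable {P P' : Program} {T T₁ T₂ : ℕ} {σ : Memory} {Q R : Memory → Prop}

theorem Runs.mono (h : Runs P T₁ σ Q) (hT : T₁ ≤ T) (hQ : ∀ τ, Q τ → R τ) : Runs P T σ R := by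
  obtain ⟨τ, t, h1, h2, h3⟩ := h
  exact ⟨τ, t, h1, h2.trans hT, hQ τ h3⟩

theorem Runs.skip (hT : 1 ≤ T) (h : Q σ) : Runs .skip T σ Q :=
  ⟨σ, 1, .skip σ, hT, h⟩

theorem Runs.assign {x : ℕ} {e : Expr} (hT : e.cost + 1 ≤ T) (h : Q (σ.setReg x (e.eval σ))) :
    Runs (.assign x e) T σ Q :=
  ⟨_, _, .assign x e σ, hT, h⟩

theorem Runs.store {a : ℕ} {e f : Expr} (hT : e.cost + f.cost + 1 ≤ T)
    (h : Q (σ.setCell a (e.eval σ) (f.eval σ))) : Runs (.store a e f) T σ Q :=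
  ⟨_, _, .store a e f σ, hT, h⟩

theorem Runs.seq (h : Runs P T₁ σ Q) (h' : ∀ τ, Q τ → Runs P' T₂ τ R) (hT : T₁ + T₂ ≤ T) :
    Runs (.seq P P') T σ R := by
  obtain ⟨τ, t, h1, h2, h3⟩ := h
  obtain ⟨ρ, s, h4, h5, h6⟩ := h' τ h3
  exact ⟨ρ, t + s, .seq h1 h4, by omega, h6⟩

theorem Runs.assign_seq {x : ℕ} {e : Expr} (h : Runs P T₁ (σ.setReg x (e.eval σ)) Q)
    (hT : e.cost + 1 + T₁ ≤ T) : Runs (.seq (.assign x e) P) T σ Q :=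
  Runs.seq (Q := fun τ => τ = σ.setReg x (e.eval σ)) (.assign le_rfl rfl)
    (fun _ hτ => hτ ▸ h) hT

theorem Runs.store_seq {a : ℕ} {e f : Expr}
    (h : Runs P T₁ (σ.setCell a (e.eval σ) (f.eval σ)) Q)
    (hT : e.cost + f.cost + 1 + T₁ ≤ T) : Runs (.seq (.store a e f) P) T σ Q :=
  Runs.seq (Q := fun τ => τ = σ.setCell a (e.eval σ) (f.eval σ)) (.store le_rfl rfl)
    (fun _ hτ => hτ ▸ h) hT

theorem Runs.ite {e : Expr} (h : e.eval σ ≠ 0 → Runs P T₁ σ Q)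
    (h' : e.eval σ = 0 → Runs P' T₁ σ Q) (hT : e.cost + 1 + T₁ ≤ T) :
    Runs (.ite e P P') T σ Q := by
  by_cases he : e.eval σ = 0
  · obtain ⟨τ, t, h1, h2, h3⟩ := h' he
    exact ⟨τ, _, .ite_false he h1, by omega, h3⟩
  · obtain ⟨τ, t, h1, h2, h3⟩ := h he
    exact ⟨τ, _, .ite_true he h1, by omega, h3⟩

/-- The rule for a loop that is executed `n` times, with an invariant that may mention the number
of completed rounds. -/
theorem Runs.while {e : Expr} (n : ℕ) (I : ℕ → Memory → Prop) (h0 : I 0 σ)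
    (hbody : ∀ i < n, ∀ τ, I i τ → e.eval τ ≠ 0 ∧ Runs P T₁ τ (I (i + 1)))
    (hend : ∀ τ, I n τ → e.eval τ = 0 ∧ Q τ)
    (hT : n * (e.cost + 1 + T₁) + (e.cost + 1) ≤ T) : Runs (.while e P) T σ Q := by
  -- Induction on the number `d` of rounds still to run, so that the bound covers only the remaining
  -- cost.
  suffices H : ∀ d i τ, i + d = n → I i τ →
      Runs (.while e P) (d * (e.cost + 1 + T₁) + (e.cost + 1)) τ Q from
    (H n 0 σ (by omega) h0).mono hT fun _ h => h
  intro d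
  induction d with
  | zero =>
    intro i τ hi hτ
    obtain ⟨h1, h2⟩ := hend τ (by rwa [← hi])
    exact ⟨τ, _, .while_false h1, by omega, h2⟩
  | succ d ih =>
    intro i τ hi hτ
    obtain ⟨h1, ρ, s, h2, h3, h4⟩ := hbody i (by omega) τ hτ
    obtain ⟨υ, t, h5, h6, h7⟩ := ih (i + 1) ρ (by omega) h4
    refine ⟨υ, _, .while_true h1 h2 h5, ?_, h7⟩
    rw [Nat.succ_mul]
    omega

/-- A program that writes to register `8` a number that is nonzero if and only if the array `a`
has an index `E` below register `b` such that the cells `p + E` and `q + E` (for registers `p` and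
`q`) hold `1`. Register `9` is the counter. -/
def overlap (a p q b : ℕ) : Program :=
  .seq (.assign 8 (.lit 0)) <| .seq (.assign 9 (.lit 0)) <|
  .while (.minus (.reg b) (.reg 9)) <|
    .seq (.assign 8 (.plus (.reg 8) (.minus (.plus (.cell a (.plus (.reg p) (.reg 9)))
      (.cell a (.plus (.reg q) (.reg 9)))) (.lit 1)))) <|
    .assign 9 (.plus (.reg 9) (.lit 1))

/-- Truncated a + b - 1 is positive exactly if a + b ≥ 2, which for 0/1 entries is conjunction;
summing these values gives the existential. The bounds on `p`, `q`, `b` keep them apart from the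
scratch registers 8 and 9. -/
theorem overlap_runs {a p q b : ℕ} (hp : p < 8) (hq : q < 8) (hb : b < 8) (σ : Memory) :
    Runs (overlap a p q b) (22 * σ.reg b + 8) σ fun τ => τ.arr = σ.arr ∧
      (∀ y, y ≠ 8 → y ≠ 9 → τ.reg y = σ.reg y) ∧
      (τ.reg 8 ≠ 0 ↔ ∃ E < σ.reg b,
        2 ≤ σ.arr a (σ.reg p + E) + σ.arr a (σ.reg q + E)) := by
  refine .assign_seq (.assign_seq (.while (T₁ := 18) (σ.reg b)
    (fun i τ => τ.arr = σ.arr ∧ (∀ y, y ≠ 8 → y ≠ 9 → τ.reg y = σ.reg y) ∧ τ.reg 9 = i ∧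
      (τ.reg 8 ≠ 0 ↔ ∃ E < i, 2 ≤ σ.arr a (σ.reg p + E) + σ.arr a (σ.reg q + E)))
    ?_ ?_ ?_ le_rfl) le_rfl) ?_
  · refine ⟨rfl, ?_, by simp, by simp⟩
    intro y h8 h9
    simp [h8, h9]
  · rintro i hi τ ⟨h1, h2, h3, h4⟩
    have e1 := h2 b (by omega) (by omega)
    have e2 := h2 p (by omega) (by omega)
    have e3 := h2 q (by omega) (by omega)
    refine ⟨by simp; omega, .assign_seq (.assign (T := 4) (by simp) ?_) (by simp)⟩
    refine ⟨h1, fun y h8 h9 => by simp [h8, h9, h2], by simp [h3], ?_⟩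
    have : (∃ E < i + 1, 2 ≤ σ.arr a (σ.reg p + E) + σ.arr a (σ.reg q + E)) ↔
        (∃ E < i, 2 ≤ σ.arr a (σ.reg p + E) + σ.arr a (σ.reg q + E)) ∨
          2 ≤ σ.arr a (σ.reg p + i) + σ.arr a (σ.reg q + i) := by
      constructor
      · rintro ⟨E, hE, h⟩
        rcases Nat.lt_succ_iff_lt_or_eq.1 hE with h' | rfl
        exacts [.inl ⟨E, h', h⟩, .inr h]
      · rintro (⟨E, hE, h⟩ | h)
        exacts [⟨E, by omega, h⟩, ⟨i, by omega, h⟩]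
    rw [this, ← h4]
    simp [h1, h3, e2, e3]
    omega
  · rintro τ ⟨h1, h2, h3, h4⟩
    have e1 := h2 b (by omega) (by omega)
    exact ⟨by simp; omega, h1, h2, h4⟩
  · simp
    omega

end RAM
-- The list of stars, defined from adjacency and k alone.
/-- The smallest vertices `D` in their classes of neighbours of `C`, for a relation `R` on `ℕ`. -/
def IsFirst (R : ℕ → ℕ → Prop) (C D : ℕ) : Prop := R C D ∧ ∀ E < D, ¬ (R C E ∧ R D E)

open Classical in
/-- The maximal clique of the relation `R` on `{0, …, N - 1}` that contains `C` and `D`. -/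
noncomputable def pairRow (R : ℕ → ℕ → Prop) (N C D : ℕ) : Finset ℕ :=
  (Finset.range N).filter fun E => E = C ∨ E = D ∨ R C E ∧ R D E

open Classical in
/-- The maximal cliques with at least two elements whose smallest element is `C` and whose second
smallest element is less than `n`. -/
noncomputable def pairRows (R : ℕ → ℕ → Prop) (N C n : ℕ) : List (Finset ℕ) :=
  (List.range n).flatMap fun D => if IsFirst R C D ∧ C < D then [pairRow R N C D] else []

open Classical in
/-- The number of classes of neighbours of `C` that have an element less than `n`. -/
noncomputable def numFirst (R : ℕ → ℕ → Prop) (C n : ℕ) : ℕ :=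
  ((Finset.range n).filter (IsFirst R C)).card

/-- The stars of all facets whose smallest element is less than `n`. -/
noncomputable def rows (R : ℕ → ℕ → Prop) (N k n : ℕ) : List (Finset ℕ) :=
  (List.range n).flatMap fun C =>
    pairRows R N C N ++ List.replicate (k - numFirst R C N) {C}

theorem pairRows_succ (R : ℕ → ℕ → Prop) (N C n : ℕ) [Decidable (IsFirst R C n ∧ C < n)] :
    pairRows R N C (n + 1) = pairRows R N C n ++
      if IsFirst R C n ∧ C < n then [pairRow R N C n] else [] := by
  simp only [pairRows, List.range_succ, List.flatMap_append, List.flatMap_singleton]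
  congr

theorem numFirst_succ (R : ℕ → ℕ → Prop) (C n : ℕ) [Decidable (IsFirst R C n)] :
    numFirst R C (n + 1) = numFirst R C n + if IsFirst R C n then 1 else 0 := by
  rw [numFirst, Finset.range_add_one, Finset.filter_insert, numFirst]
  split_ifs <;> simp

theorem rows_succ (R : ℕ → ℕ → Prop) (N k n : ℕ) :
    rows R N k (n + 1) = rows R N k n ++
      (pairRows R N n N ++ List.replicate (k - numFirst R n N) {n}) := by
  simp only [rows, List.range_succ, List.flatMap_append, List.flatMap_singleton]

theorem length_pairRows_le (R : ℕ → ℕ → Prop) (N C n : ℕ) :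
    (pairRows R N C n).length ≤ numFirst R C n := by
  classical
  induction n with
  | zero => simp [pairRows]
  | succ n ih =>
    rw [pairRows_succ, numFirst_succ, List.length_append]
    by_cases h : IsFirst R C n
    · split_ifs <;> simp <;> omega
    · simpa [h] using ih

/-- Each C contributes at most `numFirst` pair rows and exactly k - `numFirst` singletons, so at
most k rows. -/
theorem length_rows_le {R : ℕ → ℕ → Prop} {N k : ℕ} (h : ∀ C < N, numFirst R C N ≤ k) :
    ∀ n ≤ N, (rows R N k n).length ≤ k * n := by
  intro n
  induction n with
  | zero => simp [rows]
  | succ n ih =>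
    intro hn
    have h1 := ih (by omega)
    have h2 := length_pairRows_le R N n N
    have h3 := h n (by omega)
    rw [rows_succ]
    simp only [List.length_append, List.length_replicate, Nat.mul_succ]
    omega

theorem count_pairRows (R : ℕ → ℕ → Prop) (N C n : ℕ) (s : Finset ℕ)
    [DecidablePred fun D => (IsFirst R C D ∧ C < D) ∧ pairRow R N C D = s] :
    (pairRows R N C n).count s =
      ((Finset.range n).filter fun D =>
        (IsFirst R C D ∧ C < D) ∧ pairRow R N C D = s).card := by
  classical
  induction n with
  | zero => simp [pairRows]
  | succ n ih =>
    rw [pairRows_succ, List.count_append, ih, Finset.range_add_one, Finset.filter_insert]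
    by_cases h : IsFirst R C n ∧ C < n
    · by_cases h' : pairRow R N C n = s
      · rw [if_pos h, if_pos ⟨h, h'⟩, Finset.card_insert_of_notMem (by simp)]
        simp [h']
      · rw [if_pos h, if_neg fun h'' => h' h''.2]
        simp [h']
    · rw [if_neg h, if_neg fun h'' => h h''.1, List.count_nil, add_zero]

theorem count_rows (R : ℕ → ℕ → Prop) (N k n : ℕ) (s : Finset ℕ) :
    (rows R N k n).count s = ∑ C ∈ Finset.range n, ((pairRows R N C N).count s +
      if s = {C} then k - numFirst R C N else 0) := by
  classical
  induction n with
  | zero => simp [rows]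
  | succ n ih =>
    rw [rows_succ, List.count_append, ih, Finset.sum_range_succ, List.count_append,
      List.count_replicate]
    simp only [beq_iff_eq, eq_comm (a := s)]

theorem List.count_eq_card_get {α : Type*} [DecidableEq α] (l : List α) (a : α) :
    l.count a = Fintype.card {i // l.get i = a} := by
  have h := Fin.card_filter_univ_eq_vector_get_eq_count a ⟨l, rfl⟩
  rw [Fintype.card_subtype]
  refine Eq.trans h.symm (congrArg Finset.card (Finset.filter_congr fun i _ => ?_))
  exact Iff.rfl

/-! ### Incidence geometries are determined by collinearity. -/

/-- An incidence structure with points `{0, …, N - 1}`, blocks `X` and block sets `star`, in which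
each point is on `k` blocks, two points are on at most one block, `R` is collinearity, and
pairwise collinear points are on a common block. -/
structure IsGeometry {X : Type*} (R : ℕ → ℕ → Prop) (N k : ℕ) (star : X → Finset ℕ) : Prop where
  lt_of_mem : ∀ x, ∀ C ∈ star x, C < N
  nonempty : ∀ x, (star x).Nonempty
  card_blocks : ∀ C < N, Nat.card {x // C ∈ star x} = k
  unique : ∀ x y C D, C ≠ D → C ∈ star x → D ∈ star x → C ∈ star y → D ∈ star y → x = y
  rel_iff : ∀ C D, R C D ↔ C ≠ D ∧ ∃ x, C ∈ star x ∧ D ∈ star x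
  triangle : ∀ C D E, R C D → R C E → R D E → ∃ x, C ∈ star x ∧ D ∈ star x ∧ E ∈ star x

namespace IsGeometry

variable {X : Type*} {R : ℕ → ℕ → Prop} {N k : ℕ} {star : X → Finset ℕ}

/-- A point collinear with both C and D is on a common block with them by `triangle`, and `unique`
identifies this block with `x`. So two points and collinearity determine the block. -/
theorem mem_star_iff (h : IsGeometry R N k star) {x : X} {C D : ℕ} (hCD : C ≠ D)
    (hC : C ∈ star x) (hD : D ∈ star x) (E : ℕ) :
    E ∈ star x ↔ E = C ∨ E = D ∨ R C E ∧ R D E := by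
  constructor
  · intro hE
    by_cases h1 : E = C
    · exact .inl h1
    by_cases h2 : E = D
    · exact .inr (.inl h2)
    exact .inr (.inr ⟨(h.rel_iff _ _).2 ⟨Ne.symm h1, x, hC, hE⟩,
      (h.rel_iff _ _).2 ⟨Ne.symm h2, x, hD, hE⟩⟩)
  · rintro (rfl | rfl | ⟨h1, h2⟩)
    · exact hC
    · exact hD
    · obtain ⟨y, hy1, hy2, hy3⟩ := h.triangle C D E ((h.rel_iff _ _).2 ⟨hCD, x, hC, hD⟩) h1 h2
      rwa [h.unique x y C D hCD hC hD hy1 hy2]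

theorem star_eq_pairRow (h : IsGeometry R N k star) {x : X} {C D : ℕ} (hCD : C ≠ D)
    (hC : C ∈ star x) (hD : D ∈ star x) : star x = pairRow R N C D := by
  ext E
  simp only [pairRow, Finset.mem_filter, Finset.mem_range, ← h.mem_star_iff hCD hC hD]
  exact ⟨fun hE => ⟨h.lt_of_mem x E hE, hE⟩, fun hE => hE.2⟩

/-- Every block on `C` with another point contains a smallest such point. -/
theorem exists_isFirst (h : IsGeometry R N k star) {x : X} {C : ℕ} (hC : C ∈ star x)
    (hx : star x ≠ {C}) : ∃ D, D ∈ star x ∧ D ≠ C ∧ IsFirst R C D ∧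
      ∀ E ∈ star x, E ≠ C → D ≤ E := by
  have hne : ((star x).erase C).Nonempty := by
    rw [Finset.nonempty_iff_ne_empty]
    intro h0
    rcases (Finset.erase_eq_empty_iff _ _).1 h0 with h1 | h1
    · simp [h1] at hC
    · exact hx h1
  obtain ⟨D, hD, hmin⟩ : ∃ D ∈ (star x).erase C, ∀ E ∈ (star x).erase C, D ≤ E :=
    ⟨_, Finset.min'_mem _ hne, fun E hE => Finset.min'_le _ E hE⟩
  simp only [Finset.mem_erase] at hD hmin
  refine ⟨D, hD.2, hD.1, ⟨(h.rel_iff _ _).2 ⟨hD.1.symm, x, hC, hD.2⟩, ?_⟩,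
    fun E h1 h2 => hmin E ⟨h2, h1⟩⟩
  rintro E hE hR
  have h1 := (h.mem_star_iff hD.1.symm hC hD.2 E).2 (.inr (.inr hR))
  have h2 := hmin E ⟨((h.rel_iff _ _).1 hR.1).1.symm, h1⟩
  omega

/-- A first neighbour D of C is matched with the block on C and D; conversely, a block yields its
smallest point other than C. -/
theorem numFirst_eq (h : IsGeometry R N k star) [Finite X] (C : ℕ) :
    numFirst R C N = Nat.card {x // C ∈ star x ∧ star x ≠ {C}} := by
  classical
  have := Fintype.ofFinite X
  have hx : ∀ D, IsFirst R C D → ∃ x, C ∈ star x ∧ D ∈ star x := fun D hD =>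
    ((h.rel_iff _ _).1 hD.1).2
  choose f hf hf' using hx
  rw [numFirst, Nat.card_eq_fintype_card, Fintype.card_subtype]
  refine Finset.card_bij (fun D hD => f D (Finset.mem_filter.1 hD).2) ?_ ?_ ?_
  · intro D hD
    have hD := (Finset.mem_filter.1 hD).2
    simp only [Finset.mem_filter, Finset.mem_univ, true_and]
    refine ⟨hf D hD, fun h0 => ((h.rel_iff _ _).1 hD.1).1 ?_⟩
    have := hf' D hD
    rw [h0, Finset.mem_singleton] at this
    exact this.symm
  -- Two first neighbours on the same block would be collinear, so the larger one would not be
  -- first.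
  · have key : ∀ D D' hD hD', f D hD = f D' hD' → ¬ D < D' := by
      intro D D' hD hD' he hlt
      refine hD'.2 D hlt ⟨hD.1, (h.rel_iff _ _).2 ⟨by omega, f D' hD', hf' D' hD', ?_⟩⟩
      rw [← he]
      exact hf' D hD
    intro D hD D' hD' he
    have h1 := key D D' _ _ he
    have h2 := key D' D _ _ he.symm
    omega
  · intro x hx
    obtain ⟨hx1, hx2⟩ := (Finset.mem_filter.1 hx).2
    obtain ⟨D, h1, h2, h3, -⟩ := h.exists_isFirst hx1 hx2
    exact ⟨D, by simp [h3, h.lt_of_mem x D h1],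
      h.unique _ _ C D h2.symm (hf D h3) (hf' D h3) hx1 h1⟩

theorem numFirst_add (h : IsGeometry R N k star) [Finite X] {C : ℕ} (hC : C < N) :
    numFirst R C N + Nat.card {x // star x = {C}} = k := by
  classical
  have := Fintype.ofFinite X
  rw [h.numFirst_eq, ← h.card_blocks C hC]
  simp only [Nat.card_eq_fintype_card, Fintype.card_subtype]
  rw [← Finset.card_filter_add_card_filter_not (s := Finset.univ.filter fun x => C ∈ star x)
    (fun x => star x ≠ {C}), Finset.filter_filter,
    Finset.filter_filter]
  rw [Nat.add_left_cancel_iff]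
  refine congrArg Finset.card (Finset.filter_congr fun x _ => ?_)
  rw [not_not]
  exact ⟨fun hx => ⟨by simp [hx], hx⟩, fun hx => hx.2⟩

theorem numFirst_le (h : IsGeometry R N k star) [Finite X] {C : ℕ} (hC : C < N) :
    numFirst R C N ≤ k := by
  have := h.numFirst_add hC
  omega

theorem pairRow_ne_singleton (h : IsGeometry R N k star) {C D C' : ℕ} (hR : R C D) :
    pairRow R N C D ≠ {C'} := by
  obtain ⟨hne, x, hC, hD⟩ := (h.rel_iff _ _).1 hR
  rw [← h.star_eq_pairRow hne hC hD]
  intro h0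
  rw [h0, Finset.mem_singleton] at hC hD
  exact hne (hC.trans hD.symm)

/-- Pair rows have two distinct points, so only the padding contributes, and `numFirst_add` says
that it has the right length. -/
theorem count_rows_singleton (h : IsGeometry R N k star) [Finite X] (C : ℕ) :
    (rows R N k N).count {C} = Nat.card {x // star x = {C}} := by
  classical
  have h0 : ∀ C', (pairRows R N C' N).count {C} = 0 := by
    intro C'
    rw [count_pairRows, Finset.card_eq_zero, Finset.filter_eq_empty_iff]
    rintro D - ⟨⟨h1, -⟩, h2⟩
    exact h.pairRow_ne_singleton h1.1 h2
  simp only [count_rows, h0, zero_add, Finset.singleton_inj]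
  rw [Finset.sum_ite_eq]
  by_cases hC : C < N
  · have := h.numFirst_add hC
    simp only [Finset.mem_range, hC, if_true]
    omega
  · rw [if_neg (by simpa using hC), eq_comm, Nat.card_eq_zero]
    refine .inl ⟨fun x => hC (h.lt_of_mem x.1 C ?_)⟩
    rw [x.2]
    exact Finset.mem_singleton_self C

/-- Both counts are at most 1: on the left, s determines C and D as its two smallest elements; on
the right, two points determine the block. It then suffices that one is positive exactly if the
other is. -/
theorem count_rows_of_ne_singleton (h : IsGeometry R N k star) [Finite X] {s : Finset ℕ}
    (hs : ∀ C, s ≠ {C}) : (rows R N k N).count s = Nat.card {x // star x = s} := by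
  classical
  have := Fintype.ofFinite X
  simp only [count_rows, if_neg (hs _), add_zero, count_pairRows]
  rw [← Finset.card_sigma, Nat.card_eq_fintype_card, Fintype.card_subtype]
  have hP : ∀ {C D}, IsFirst R C D → C < D → pairRow R N C D = s →
      ∃ x, star x = s ∧ C ∈ s ∧ D ∈ s ∧ ∀ E ∈ s, E = C ∨ D ≤ E := by
    intro C D h1 h2 h3
    obtain ⟨hne, x, hC, hD⟩ := (h.rel_iff _ _).1 h1.1
    have hx := (h.star_eq_pairRow hne hC hD).trans h3
    refine ⟨x, hx, hx ▸ hC, hx ▸ hD, fun E hE => ?_⟩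
    rw [← hx, h.mem_star_iff hne hC hD] at hE
    rcases hE with hE | hE | hE
    · exact .inl hE
    · exact .inr hE.ge
    · refine .inr ?_
      by_contra hlt
      exact h1.2 E (by omega) hE
  have card_eq : ∀ {α β : Type _} (u : Finset α) (v : Finset β), u.card ≤ 1 → v.card ≤ 1 →
      (u.Nonempty ↔ v.Nonempty) → u.card = v.card := by
    intro α β u v hu hv huv
    rw [← Finset.card_pos, ← Finset.card_pos] at huv
    omega
  apply card_eq
  · rw [Finset.card_le_one]
    rintro ⟨C, D⟩ h1 ⟨C', D'⟩ h2
    simp only [Finset.mem_sigma, Finset.mem_filter, Finset.mem_range] at h1 h2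
    obtain ⟨-, -, a2, a3, a4⟩ := hP h1.2.2.1.1 h1.2.2.1.2 h1.2.2.2
    obtain ⟨-, -, b2, b3, b4⟩ := hP h2.2.2.1.1 h2.2.2.1.2 h2.2.2.2
    have c1 := a4 C' b2
    have c2 := a4 D' b3
    have c3 := b4 C a2
    have c4 := b4 D a3
    have d1 := h1.2.2.1.2
    have d2 := h2.2.2.1.2
    obtain rfl : C = C' := by omega
    obtain rfl : D = D' := by omega
    rfl
  · rw [Finset.card_le_one]
    intro x hx y hy
    simp only [Finset.mem_filter, Finset.mem_univ, true_and] at hx hy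
    obtain ⟨C, hC⟩ := h.nonempty x
    obtain ⟨D, hD, hne, -⟩ := h.exists_isFirst hC (hx ▸ hs C)
    exact h.unique x y C D hne.symm hC hD (hy ▸ hx ▸ hC) (hy ▸ hx ▸ hD)
  · constructor
    · rintro ⟨⟨C, D⟩, h1⟩
      simp only [Finset.mem_sigma, Finset.mem_filter, Finset.mem_range] at h1
      obtain ⟨x, hx, -⟩ := hP h1.2.2.1.1 h1.2.2.1.2 h1.2.2.2
      exact ⟨x, by simp [hx]⟩
    · rintro ⟨x, hx⟩
      have hx : star x = s := by simpa using hx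
      obtain ⟨C, hC, hmin⟩ : ∃ C ∈ star x, ∀ E ∈ star x, C ≤ E :=
        ⟨_, Finset.min'_mem _ (h.nonempty x), fun E hE => Finset.min'_le _ E hE⟩
      obtain ⟨D, hD, hne, hfirst, -⟩ := h.exists_isFirst hC (hx ▸ hs C)
      have hlt : C < D := lt_of_le_of_ne (hmin D hD) hne.symm
      refine ⟨⟨C, D⟩, ?_⟩
      simp only [Finset.mem_sigma, Finset.mem_filter, Finset.mem_range]
      exact ⟨h.lt_of_mem x C hC, h.lt_of_mem x D hD, ⟨hfirst, hlt⟩,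
        (h.star_eq_pairRow hne.symm hC hD).symm.trans hx⟩

theorem count_rows_eq (h : IsGeometry R N k star) [Finite X] (s : Finset ℕ) :
    (rows R N k N).count s = Nat.card {x // star x = s} := by
  by_cases hs : ∃ C, s = {C}
  · obtain ⟨C, rfl⟩ := hs
    exact h.count_rows_singleton C
  · exact h.count_rows_of_ne_singleton (not_exists.1 hs)

/-- The rows computed from collinearity alone are the block sets, with their multiplicities. -/
theorem exists_equiv (h : IsGeometry R N k star) [Finite X] :
    ∃ e : X ≃ Fin (rows R N k N).length, ∀ x, (rows R N k N).get (e x) = star x := by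
  classical
  have := Fintype.ofFinite X
  -- Equal multiplicities give bijections between the fibres of `star` and of `get`, which are then
  -- glued.
  have key : ∀ s, Nonempty ({x // star x = s} ≃ {i // (rows R N k N).get i = s}) := by
    intro s
    refine Finite.card_eq.1 ?_
    rw [← h.count_rows_eq, Nat.card_eq_fintype_card, List.count_eq_card_get]
  refine ⟨Equiv.ofFiberEquiv (f := star) fun s => (key s).some, fun x => ?_⟩
  exact Equiv.ofFiberEquiv_map (f := star) (fun s => (key s).some) x

end IsGeometry
-- The program that tabulates the stars.
/-- The adjacency relation of a graph on `Fin N`, as a relation on `ℕ`. -/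
def natAdj {N : ℕ} (T : SimpleGraph (Fin N)) (i j : ℕ) : Prop :=
  ∃ (hi : i < N) (hj : j < N), T.Adj ⟨i, hi⟩ ⟨j, hj⟩

/-- The intersection graph of a list of subsets of `{0, …, N - 1}`. -/
def rowGraph (N : ℕ) (l : List (Finset ℕ)) : SimpleGraph (Fin l.length) where
  Adj x y := x ≠ y ∧ ∃ E < N, E ∈ l.get x ∧ E ∈ l.get y
  symm := ⟨fun _ _ ⟨h, E, hE, hx, hy⟩ => ⟨h.symm, E, hE, hy, hx⟩⟩
  loopless := ⟨fun _ h => h.1 rfl⟩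

theorem natAdj_rowGraph {N : ℕ} {l : List (Finset ℕ)} {x y : ℕ} (hx : x < l.length)
    (hy : y < l.length) : natAdj (rowGraph N l) x y ↔
      x ≠ y ∧ ∃ E < N, E ∈ l.getD x ∅ ∧ E ∈ l.getD y ∅ := by
  simp [natAdj, rowGraph, hx, hy]

namespace RAM

theorem mul_add_inj {N x y E F : ℕ} (hE : E < N) (hF : F < N) :
    x * N + E = y * N + F ↔ x = y ∧ E = F := by
  constructor
  · intro h
    have hN : 0 < N := by omega
    have h1 := congrArg (· / N) h
    have h2 := congrArg (· % N) h
    simp only [mul_comm _ N, Nat.mul_add_div hN, Nat.div_eq_of_lt hE, Nat.div_eq_of_lt hF,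
      Nat.mul_add_mod, Nat.mod_eq_of_lt hE, Nat.mod_eq_of_lt hF, add_zero] at h1 h2
    exact ⟨h1, h2⟩
  · rintro ⟨rfl, rfl⟩
    rfl

theorem adjArray_apply {N : ℕ} (T : SimpleGraph (Fin N)) {i j : ℕ} (hj : j < N)
    [Decidable (natAdj T i j)] : adjArray T (i * N + j) = if natAdj T i j then 1 else 0 := by
  classical
  rw [adjArray]
  refine if_congr ?_ rfl rfl
  constructor
  · rintro ⟨x, y, h, hT⟩
    obtain ⟨rfl, rfl⟩ := (mul_add_inj hj y.2).1 h
    exact ⟨x.2, y.2, hT⟩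
  · rintro ⟨h1, h2, hT⟩
    exact ⟨_, _, rfl, hT⟩

/-- The array `b` holds the incidence matrix of the list `l` of subsets of `{0, …, N - 1}`, one row
for each list entry, followed by zeros. -/
def HoldsRows (N : ℕ) (l : List (Finset ℕ)) (b : ℕ → ℕ) : Prop :=
  ∀ x, ∀ E < N, b (x * N + E) = if E ∈ l.getD x ∅ then 1 else 0

theorem List.getD_concat {α : Type*} (l : List α) (s d : α) (x : ℕ) :
    (l ++ [s]).getD x d = if x = l.length then s else l.getD x d := by
  rcases lt_trichotomy x l.length with h | rfl | h
  · rw [List.getD_append _ _ _ _ h, if_neg h.ne]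
  · simp
  · rw [if_neg h.ne', List.getD_eq_default _ _ h.le, List.getD_eq_default]
    simp
    omega

/-- Cells beyond the last row are 0, the default row being ∅, so a new row is opened without any
write. -/
theorem HoldsRows.concat_empty {N : ℕ} {l : List (Finset ℕ)} {b : ℕ → ℕ} (h : HoldsRows N l b) :
    HoldsRows N (l ++ [∅]) b := by
  intro x E hE
  rw [h x E hE, List.getD_concat]
  by_cases hx : x = l.length
  · simp [hx]
  · rw [if_neg hx]

theorem HoldsRows.update {N : ℕ} {l : List (Finset ℕ)} {s s' : Finset ℕ} {b : ℕ → ℕ} {E v : ℕ}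
    (h : HoldsRows N (l ++ [s]) b) (hE : E < N) (hv : v = if E ∈ s' then 1 else 0)
    (hs : ∀ F, F ≠ E → (F ∈ s' ↔ F ∈ s)) :
    HoldsRows N (l ++ [s']) (Function.update b (l.length * N + E) v) := by
  intro x F hF
  simp only [Function.update_apply, mul_add_inj hF hE]
  rw [h x F hF, List.getD_concat, List.getD_concat]
  by_cases hx : x = l.length
  · by_cases hFE : F = E
    · simp [hx, hFE, hv]
    · simp [hx, hFE, hs]
  · simp [hx]

theorem HoldsRows.insert {N : ℕ} {l : List (Finset ℕ)} {s : Finset ℕ} {b : ℕ → ℕ} {E : ℕ}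
    (h : HoldsRows N (l ++ [s]) b) (hE : E < N) :
    HoldsRows N (l ++ [insert E s]) (Function.update b (l.length * N + E) 1) :=
  h.update hE (by simp) fun F hF => by simp [hF]

/-- The state of the computation of the rows: the input is still there, and register `2` and array
`2` hold the number of rows found so far and their incidence matrix. -/
structure Table {N : ℕ} (T : SimpleGraph (Fin N)) (k : ℕ) (l : List (Finset ℕ)) (σ : Memory) :
    Prop where
  reg0 : σ.reg 0 = N
  reg1 : σ.reg 1 = k
  reg2 : σ.reg 2 = l.length
  reg3 : σ.reg 3 = l.length * N
  arr0 : σ.arr 0 = adjArray T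
  arr1 : σ.arr 1 = fun _ => 0
  arr2 : HoldsRows N l (σ.arr 2)

variable {N : ℕ} {T : SimpleGraph (Fin N)} {k : ℕ} {l : List (Finset ℕ)}

theorem Table.congr {σ τ : Memory} (h : Table T k l σ) (harr : τ.arr = σ.arr)
    (hreg : ∀ y < 4, τ.reg y = σ.reg y) : Table T k l τ :=
  ⟨by rw [hreg 0 (by omega), h.reg0], by rw [hreg 1 (by omega), h.reg1],
    by rw [hreg 2 (by omega), h.reg2], by rw [hreg 3 (by omega), h.reg3],
    by rw [harr, h.arr0], by rw [harr, h.arr1], by rw [harr]; exact h.arr2⟩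

/-- Append the row of the vertices in registers `4` and `5`; registers `6` and `7` hold the
beginnings of their rows in the adjacency matrix. -/
def pushPair : Program :=
  .seq (.assign 9 (.lit 0)) <|
  .seq (.while (.minus (.reg 0) (.reg 9)) <|
    .seq (.store 2 (.plus (.reg 3) (.reg 9))
      (.minus (.plus (.cell 0 (.plus (.reg 6) (.reg 9)))
        (.cell 0 (.plus (.reg 7) (.reg 9)))) (.lit 1))) <|
    .assign 9 (.plus (.reg 9) (.lit 1))) <|
  .seq (.store 2 (.plus (.reg 3) (.reg 4)) (.lit 1)) <|
  .seq (.store 2 (.plus (.reg 3) (.reg 5)) (.lit 1)) <|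
  .seq (.assign 3 (.plus (.reg 3) (.reg 0))) <|
  .assign 2 (.plus (.reg 2) (.lit 1))

theorem pushPair_runs {C D : ℕ} (hC : C < N) (hD : D < N) {σ : Memory} (h : Table T k l σ)
    (h4 : σ.reg 4 = C) (h5 : σ.reg 5 = D) (h6 : σ.reg 6 = C * N) (h7 : σ.reg 7 = D * N) :
    Runs pushPair (23 * N + 30) σ fun τ => Table T k (l ++ [pairRow (natAdj T) N C D]) τ ∧
      ∀ y, 4 ≤ y → y ≠ 9 → τ.reg y = σ.reg y := by
  classical
  -- The loop writes only the common neighbours. These omit C and D because the graph has no loops;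
  -- the two stores after the loop add them.
  let s : ℕ → Finset ℕ := fun i =>
    (Finset.range i).filter fun E => natAdj T C E ∧ natAdj T D E
  refine .assign_seq (T₁ := 23 * N + 28) (.seq (T₁ := 23 * N + 4) (T₂ := 24)
    (Q := fun τ => (∀ y, y ≠ 9 → τ.reg y = σ.reg y) ∧ τ.arr 0 = adjArray T ∧
      τ.arr 1 = (fun _ => 0) ∧ HoldsRows N (l ++ [s N]) (τ.arr 2))
    (.while (T₁ := 19) N (fun i τ => τ.reg 9 = i ∧ (∀ y, y ≠ 9 → τ.reg y = σ.reg y) ∧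
      τ.arr 0 = adjArray T ∧ τ.arr 1 = (fun _ => 0) ∧ HoldsRows N (l ++ [s i]) (τ.arr 2))
    ?_ ?_ ?_ (by simp; omega)) ?_ (by omega)) (by simp; omega)
  · exact ⟨by simp, fun y hy => by simp [hy], h.arr0, h.arr1, h.arr2.concat_empty⟩
  · rintro i hi τ ⟨h1, h2, h3, h4', h5'⟩
    refine ⟨by simp [h1, h2, h.reg0]; omega,
      .store_seq (T₁ := 4) (.assign (by simp) ?_) (by simp)⟩
    refine ⟨by simp [h1], fun y hy => by simp [hy, h2], ?_, ?_, ?_⟩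
    · rw [Memory.setReg_arr, Memory.setCell_arr_of_ne _ _ _ (by omega), h3]
    · rw [Memory.setReg_arr, Memory.setCell_arr_of_ne _ _ _ (by omega), h4']
    · rw [Memory.setReg_arr, Memory.setCell_arr_self]
      have e1 : (Expr.plus (.reg 3) (.reg 9)).eval τ = l.length * N + i := by
        simp [h1, h2, h.reg3]
      rw [e1]
      refine h5'.update hi ?_ ?_
      · simp only [Expr.eval, h1, h2 6 (by omega), h2 7 (by omega), h3, h6, h7,
          adjArray_apply T hi]
        by_cases c1 : natAdj T C i <;> by_cases c2 : natAdj T D i <;> simp [s, c1, c2]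
      · intro F hF
        simp only [s, Finset.mem_filter, Finset.mem_range]
        have : F < i + 1 ↔ F < i := by omega
        rw [this]
  · rintro τ ⟨h1, h2⟩
    exact ⟨by simp [h1, h2.1, h.reg0], h2⟩
  · rintro τ ⟨h1, h2, h3, h4'⟩
    refine .store_seq (T₁ := 18) (.store_seq (T₁ := 13) (.assign_seq (T₁ := 8)
      (.assign (by simp) ?_) (by simp)) (by simp)) (by simp)
    refine ⟨⟨?_, ?_, ?_, ?_, ?_, ?_, ?_⟩, ?_⟩
    · simp [h1, h.reg0]
    · simp [h1, h.reg1]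
    · simp [h1, h.reg2]
    · simp [h1, h.reg3, h.reg0, Nat.add_mul]
    · simp only [Memory.setReg_arr]
      rw [Memory.setCell_arr_of_ne _ _ _ (by omega), Memory.setCell_arr_of_ne _ _ _ (by omega), h2]
    · simp only [Memory.setReg_arr]
      rw [Memory.setCell_arr_of_ne _ _ _ (by omega), Memory.setCell_arr_of_ne _ _ _ (by omega), h3]
    · simp only [Memory.setReg_arr, Memory.setCell_arr_self, Expr.eval, Memory.setCell_reg,
        h1 3 (by omega), h1 4 (by omega), h1 5 (by omega), h4, h5, h.reg3]
      have e : pairRow (natAdj T) N C D = insert D (insert C (s N)) := by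
        ext E
        simp only [pairRow, s, Finset.mem_filter, Finset.mem_range, Finset.mem_insert]
        constructor
        · tauto
        · rintro (rfl | rfl | ⟨a, b⟩) <;> simp [*]
      rw [e]
      exact (h4'.insert hC).insert hD
    · intro y hy hy9
      simp [h1 y hy9, show y ≠ 2 by omega, show y ≠ 3 by omega]

/-- For each `D`, if `D` is the first vertex in its class of neighbours of the vertex in register
`4`, decrement register `10`, and append the row of the class if that vertex is its minimum. -/
def pairLoop : Program :=
  .while (.minus (.reg 0) (.reg 5)) <|
    .seq (.ite (.cell 0 (.plus (.reg 6) (.reg 5)))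
      (.seq (overlap 0 6 7 5) <| .ite (.reg 8) .skip <|
        .seq (.assign 10 (.minus (.reg 10) (.lit 1))) <|
        .ite (.minus (.reg 5) (.reg 4)) pushPair .skip)
      .skip) <|
    .seq (.assign 5 (.plus (.reg 5) (.lit 1))) <|
    .assign 7 (.plus (.reg 7) (.reg 0))

theorem pairLoop_runs {C : ℕ} (hC : C < N) {σ : Memory} (h : Table T k l σ)
    (h4 : σ.reg 4 = C) (h5 : σ.reg 5 = 0) (h6 : σ.reg 6 = C * N) (h7 : σ.reg 7 = 0)
    (h10 : σ.reg 10 = k) :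
    Runs pairLoop (N * (45 * N + 70) + 4) σ fun τ =>
      Table T k (l ++ pairRows (natAdj T) N C N) τ ∧ τ.reg 4 = C ∧ τ.reg 6 = C * N ∧
        τ.reg 10 = k - numFirst (natAdj T) C N := by
  classical
  refine .while (T₁ := 45 * N + 66) N (fun D τ =>
      Table T k (l ++ pairRows (natAdj T) N C D) τ ∧ τ.reg 4 = C ∧ τ.reg 5 = D ∧
        τ.reg 6 = C * N ∧ τ.reg 7 = D * N ∧ τ.reg 10 = k - numFirst (natAdj T) C D)
    ?_ ?_ ?_ (by simp [Nat.mul_add]; omega)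
  · exact ⟨by simpa [pairRows] using h, h4, h5, h6, by simpa using h7, by simpa [numFirst] using h10⟩
  · rintro D hD τ ⟨i1, i2, i3, i4, i5, i6⟩
    refine ⟨by simp [i1.reg0, i3]; omega, .seq (T₁ := 45 * N + 58) (T₂ := 8) (Q := fun ρ =>
      Table T k (l ++ pairRows (natAdj T) N C (D + 1)) ρ ∧ ρ.reg 4 = C ∧ ρ.reg 5 = D ∧
        ρ.reg 6 = C * N ∧ ρ.reg 7 = D * N ∧ ρ.reg 10 = k - numFirst (natAdj T) C (D + 1))
      (.ite (T₁ := 45 * N + 53) ?_ ?_ (by simp; omega)) ?_ (by omega)⟩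
    · intro hA
      simp only [Expr.eval, i1.arr0, i3, i4, adjArray_apply T hD] at hA
      have hA : natAdj T C D := by by_contra h'; simp [h'] at hA
      refine .seq (T₁ := 22 * N + 8) (T₂ := 23 * N + 45)
        ((overlap_runs (by omega) (by omega) (by omega) τ).mono (by rw [i3]; omega)
          fun _ h => h) ?_ (by omega)
      rintro ρ ⟨e1, e2, e3⟩
      -- The search stops at register 5, which holds D, so it sees exactly the common neighbours
      -- below D.
      have e3 : ρ.reg 8 = 0 ↔ IsFirst (natAdj T) C D := by
        rw [← not_iff_not]
        refine e3.trans ?_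
        rw [IsFirst]
        simp only [hA, true_and, not_forall, not_not, i3, exists_prop]
        refine exists_congr fun E => and_congr_right fun hE => ?_
        rw [i4, i5, i1.arr0, adjArray_apply T (by omega), adjArray_apply T (by omega)]
        by_cases c1 : natAdj T C E <;> by_cases c2 : natAdj T D E <;> simp [c1, c2]
      have hρ := i1.congr e1 fun y hy => e2 y (by omega) (by omega)
      rw [← e2 _ (by omega) (by omega)] at i2 i3 i4 i5 i6
      refine .ite (T₁ := 23 * N + 43) ?_ ?_ (by simp; omega)
      · intro h8
        have hn : ¬ IsFirst (natAdj T) C D := fun h' => h8 (e3.2 h')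
        refine .skip (by omega) ⟨?_, i2, i3, i4, i5, ?_⟩
        · simpa [pairRows_succ, hn] using hρ
        · simpa [numFirst_succ, hn] using i6
      · intro h8
        have hf : IsFirst (natAdj T) C D := e3.1 h8
        refine .assign_seq (T₁ := 23 * N + 36) (.ite (T₁ := 23 * N + 30) ?_ ?_
          (by simp; omega)) (by simp; omega)
        · intro hlt
          simp [i2, i3, Nat.sub_eq_zero_iff_le] at hlt
          refine (pushPair_runs hC hD (σ := ρ.setReg 10 _) (l := l ++ pairRows (natAdj T) N C D) (T := T) (k := k)
            (hρ.congr rfl fun y hy => ?_) (by simpa) (by simpa) (by simpa) (by simpa)).mono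
            le_rfl ?_
          · simp [show y ≠ 10 by omega]
          · rintro υ ⟨u1, u2⟩
            refine ⟨?_, ?_, ?_, ?_, ?_, ?_⟩
            · simpa [pairRows_succ, hf, hlt] using u1
            · simpa [u2] using i2
            · simpa [u2] using i3
            · simpa [u2] using i4
            · simpa [u2] using i5
            -- Here (k - f) - 1 = k - (f + 1) also under truncation, so no bound f ≤ k is needed.
            · simp [u2, i6, numFirst_succ, hf]
              omega
        · intro hge
          simp [i2, i3, Nat.sub_eq_zero_iff_le] at hge
          refine .skip (by omega) ⟨?_, by simpa, by simpa, by simpa, by simpa, ?_⟩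
          · have hn : ¬ C < D := by omega
            have : Table T k (l ++ pairRows (natAdj T) N C (D + 1)) ρ := by
              simpa [pairRows_succ, hn] using hρ
            exact this.congr rfl fun y hy => by simp [show y ≠ 10 by omega]
          · simp [i6, numFirst_succ, hf]
            omega
    · intro hA
      simp only [Expr.eval, i1.arr0, i3, i4, adjArray_apply T hD] at hA
      have hA : ¬ natAdj T C D := by intro h'; simp [h'] at hA
      have hn : ¬ IsFirst (natAdj T) C D := fun h' => hA h'.1
      refine .skip (by omega) ⟨?_, i2, i3, i4, i5, ?_⟩
      · simpa [pairRows_succ, hn] using i1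
      · simpa [numFirst_succ, hn] using i6
    · rintro ρ ⟨j1, j2, j3, j4, j5, j6⟩
      refine .assign_seq (T₁ := 4) (.assign (by simp) ⟨?_, ?_, ?_, ?_, ?_, ?_⟩) (by simp)
      · refine j1.congr rfl fun y hy => ?_
        simp [show y ≠ 5 by omega, show y ≠ 7 by omega]
      · simpa
      · simpa
      · simpa
      · simp [j5, j1.reg0, Nat.add_mul]
      · simpa
  · rintro τ ⟨i1, i2, i3, i4, i5, i6⟩
    exact ⟨by simp [i1.reg0, i3], i1, i2, i4, i6⟩

/-- Append as many rows of the vertex in register `4` alone as register `10` says. -/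
def singleLoop : Program :=
  .while (.reg 10) <|
    .seq (.store 2 (.plus (.reg 3) (.reg 4)) (.lit 1)) <|
    .seq (.assign 3 (.plus (.reg 3) (.reg 0))) <|
    .seq (.assign 2 (.plus (.reg 2) (.lit 1))) <|
    .assign 10 (.minus (.reg 10) (.lit 1))

theorem singleLoop_runs {C n : ℕ} (hC : C < N) {σ : Memory} (h : Table T k l σ)
    (h4 : σ.reg 4 = C) (h6 : σ.reg 6 = C * N) (h10 : σ.reg 10 = n) :
    Runs singleLoop (n * 19 + 2) σ fun τ =>
      Table T k (l ++ List.replicate n {C}) τ ∧ τ.reg 4 = C ∧ τ.reg 6 = C * N := by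
  refine .while (T₁ := 17) n (fun i τ => Table T k (l ++ List.replicate i {C}) τ ∧
    τ.reg 4 = C ∧ τ.reg 6 = C * N ∧ τ.reg 10 = n - i) ?_ ?_ ?_ (by simp)
  · exact ⟨by simpa using h, h4, h6, by simpa using h10⟩
  · rintro i hi τ ⟨i1, i2, i3, i4⟩
    refine ⟨by simp [i4]; omega, .store_seq (T₁ := 12) (.assign_seq (T₁ := 8)
      (.assign_seq (T₁ := 4) (.assign (by simp) ⟨⟨?_, ?_, ?_, ?_, ?_, ?_, ?_⟩, ?_, ?_, ?_⟩)
      (by simp)) (by simp)) (by simp)⟩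
    · simp [i1.reg0]
    · simp [i1.reg1]
    · simp [i1.reg2]
      omega
    · simp [i1.reg3, i1.reg0]
      ring
    · simp only [Memory.setReg_arr]
      rw [Memory.setCell_arr_of_ne _ _ _ (by omega), i1.arr0]
    · simp only [Memory.setReg_arr]
      rw [Memory.setCell_arr_of_ne _ _ _ (by omega), i1.arr1]
    · simp only [Memory.setReg_arr, Memory.setCell_arr_self, Expr.eval, i1.reg3, i2]
      rw [List.replicate_succ', ← List.append_assoc]
      exact i1.arr2.concat_empty.insert hC
    · simp [i2]
    · simp [i3]
    · simp [i4]
      omega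
  · rintro τ ⟨i1, i2, i3, i4⟩
    exact ⟨by simp [i4], i1, i2, i3⟩

/-- Compute all rows. -/
def rowsProgram : Program :=
  .while (.minus (.reg 0) (.reg 4)) <|
    .seq (.assign 10 (.reg 1)) <|
    .seq (.assign 5 (.lit 0)) <|
    .seq (.assign 7 (.lit 0)) <|
    .seq pairLoop <|
    .seq singleLoop <|
    .seq (.assign 4 (.plus (.reg 4) (.lit 1))) <|
    .assign 6 (.plus (.reg 6) (.reg 0))

theorem rowsProgram_runs (T : SimpleGraph (Fin N)) (k : ℕ) :
    Runs rowsProgram (N * (N * (45 * N + 70) + 19 * k + 24) + 4) (inputMemory T k)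
      (Table T k (rows (natAdj T) N k N)) := by
  refine .while (T₁ := N * (45 * N + 70) + 19 * k + 20) N (fun C τ =>
    Table T k (rows (natAdj T) N k C) τ ∧ τ.reg 4 = C ∧ τ.reg 6 = C * N) ?_ ?_ ?_
    (by simp [Nat.mul_add]; omega)
  · refine ⟨⟨rfl, rfl, ?_, ?_, rfl, rfl, ?_⟩, ?_, ?_⟩
    · simp [inputMemory, rows]
    · simp [inputMemory, rows]
    · intro x E hE
      simp [inputMemory, rows]
    · simp [inputMemory]
    · simp [inputMemory]
  · rintro C hC τ ⟨i1, i2, i3⟩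
    refine ⟨by simp [i1.reg0, i2]; omega, .assign_seq (T₁ := N * (45 * N + 70) + 19 * k + 18)
      (.assign_seq (T₁ := N * (45 * N + 70) + 19 * k + 16)
      (.assign_seq (T₁ := N * (45 * N + 70) + 19 * k + 14)
      (.seq (T₂ := 19 * k + 10) (pairLoop_runs (T := T) (k := k) (l := rows (natAdj T) N k C) hC
        (i1.congr rfl fun y hy => ?_) (by simpa) (by simp) (by simpa) (by simp)
        (by simpa using i1.reg1)) ?_ (by omega)) (by simp; omega)) (by simp; omega))
      (by simp; omega)⟩
    · simp [show y ≠ 5 by omega, show y ≠ 7 by omega, show y ≠ 10 by omega]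
    · rintro ρ ⟨j1, j2, j3, j4⟩
      refine .seq (T₁ := 19 * k + 2) (T₂ := 8) ((singleLoop_runs hC j1 j2 j3 j4).mono (by omega)
        fun _ h => h) ?_ (by omega)
      rintro υ ⟨u1, u2, u3⟩
      refine .assign_seq (T₁ := 4) (.assign (by simp) ⟨?_, ?_, ?_⟩) (by simp)
      · rw [rows_succ, ← List.append_assoc]
        exact u1.congr rfl fun y hy => by simp [show y ≠ 4 by omega, show y ≠ 6 by omega]
      · simp [u2]
      · simp [u3, u1.reg0, Nat.add_mul]
  · rintro τ ⟨i1, i2, i3⟩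
    exact ⟨by simp [i1.reg0, i2], i1⟩

end RAM
-- The program that writes the intersection graph, and the total running time.
namespace RAM

variable {N : ℕ} {T : SimpleGraph (Fin N)} {k : ℕ} {l : List (Finset ℕ)}

/-- The state of the computation of the intersection graph: its adjacency matrix has been written
up to the entry in row `x` and column `y`. -/
structure MatrixState (N : ℕ) (l : List (Finset ℕ)) (x y : ℕ) (σ : Memory) : Prop where
  reg0 : σ.reg 0 = N
  reg2 : σ.reg 2 = l.length
  reg4 : σ.reg 4 = x
  reg6 : σ.reg 6 = x * N
  reg10 : σ.reg 10 = x * l.length + y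
  arr2 : HoldsRows N l (σ.arr 2)
  arr1 : ∀ j, σ.arr 1 j = if j < x * l.length + y then adjArray (rowGraph N l) j else 0

/-- Write one row of the adjacency matrix of the intersection graph. -/
def matrixRow : Program :=
  .while (.minus (.reg 2) (.reg 5)) <|
    .seq (overlap 2 6 7 0) <|
    .seq (.ite (.reg 8)
      (.ite (.plus (.minus (.reg 4) (.reg 5)) (.minus (.reg 5) (.reg 4)))
        (.store 1 (.reg 10) (.lit 1)) .skip) .skip) <|
    .seq (.assign 10 (.plus (.reg 10) (.lit 1))) <|
    .seq (.assign 5 (.plus (.reg 5) (.lit 1))) <|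
    .assign 7 (.plus (.reg 7) (.reg 0))

theorem matrixRow_runs {x : ℕ} (hx : x < l.length) {σ : Memory} (h : MatrixState N l x 0 σ)
    (h5 : σ.reg 5 = 0) (h7 : σ.reg 7 = 0) :
    Runs matrixRow (l.length * (22 * N + 37) + 4) σ (MatrixState N l x l.length) := by
  classical
  refine .while (T₁ := 22 * N + 33) l.length (fun y τ =>
    MatrixState N l x y τ ∧ τ.reg 5 = y ∧ τ.reg 7 = y * N) ?_ ?_ ?_ (by simp [Nat.mul_add]; omega)
  · exact ⟨h, h5, by simpa using h7⟩
  · rintro y hy τ ⟨i1, i2, i3⟩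
    refine ⟨by simp [i1.reg2, i2]; omega, .seq (T₁ := 22 * N + 8) (T₂ := 25)
      ((overlap_runs (by omega) (by omega) (by omega) τ).mono (by rw [i1.reg0])
        fun _ h => h) ?_ (by omega)⟩
    rintro ρ ⟨e1, e2, e3⟩
    have e3 : ρ.reg 8 ≠ 0 ↔ ∃ E < N, E ∈ l.getD x ∅ ∧ E ∈ l.getD y ∅ := by
      refine e3.trans ?_
      rw [i1.reg0]
      refine exists_congr fun E => and_congr_right fun hE => ?_
      rw [i1.reg6, i3, i1.arr2 x E hE, i1.arr2 y E hE]
      by_cases c1 : E ∈ l.getD x ∅ <;> by_cases c2 : E ∈ l.getD y ∅ <;> simp only [c1, c2] <;> simp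
    have hH := adjArray_apply (rowGraph N l) (i := x) hy
    rw [if_congr ((natAdj_rowGraph hx hy).trans (and_congr_right fun _ => e3.symm)) rfl rfl] at hH
    refine .seq (T₁ := 13) (T₂ := 12) (Q := fun υ => υ.reg = ρ.reg ∧ υ.arr 2 = ρ.arr 2 ∧
      υ.arr 1 = Function.update (ρ.arr 1) (x * l.length + y)
        (adjArray (rowGraph N l) (x * l.length + y))) ?_ ?_ (by omega)
    -- Cells not yet reached are 0, so skipping a zero entry amounts to writing it.
    · have hskip : adjArray (rowGraph N l) (x * l.length + y) = 0 →
          ρ.arr 1 = Function.update (ρ.arr 1) (x * l.length + y)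
            (adjArray (rowGraph N l) (x * l.length + y)) := by
        intro h0
        refine (Function.update_eq_self_iff.2 ?_).symm
        rw [h0, e1, i1.arr1]
        simp
      have r4 := (e2 4 (by omega) (by omega)).trans i1.reg4
      have r5 := (e2 5 (by omega) (by omega)).trans i2
      have r10 := (e2 10 (by omega) (by omega)).trans i1.reg10
      refine .ite (T₁ := 11) (fun h8 => .ite (T₁ := 3) ?_ ?_ (by simp)) ?_ (by simp)
      -- The test is (x - y) + (y - x), which is nonzero exactly off the diagonal.
      · intro hne
        have hne : x ≠ y := by
          rintro rfl
          simp [r4, r5] at hne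
        refine .store (by simp) ⟨rfl, ?_, ?_⟩
        · rw [Memory.setCell_arr_of_ne _ _ _ (by omega)]
        · rw [Memory.setCell_arr_self, hH, if_pos ⟨hne, h8⟩]
          simp [r10]
      · intro he
        have he : x = y := by
          simp [r4, r5] at he
          omega
        exact .skip (by omega) ⟨rfl, rfl, hskip (by rw [hH, if_neg fun h => h.1 he])⟩
      · intro h8
        exact .skip (by omega) ⟨rfl, rfl, hskip (by rw [hH, if_neg fun h => h.2 h8])⟩
    · rintro υ ⟨u1, u2, u3⟩
      have hreg : ∀ y < 8, υ.reg y = τ.reg y := fun y hy => by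
        rw [u1, e2 y (by omega) (by omega)]
      have hreg10 : υ.reg 10 = τ.reg 10 := by
        rw [u1, e2 10 (by omega) (by omega)]
      refine .assign_seq (T₁ := 8) (.assign_seq (T₁ := 4) (.assign (by simp)
        ⟨⟨?_, ?_, ?_, ?_, ?_, ?_, ?_⟩, ?_, ?_⟩) (by simp)) (by simp)
      · simp [hreg, i1.reg0]
      · simp [hreg, i1.reg2]
      · simp [hreg, i1.reg4]
      · simp [hreg, i1.reg6]
      · simp [hreg10, i1.reg10, add_assoc]
      · simpa only [Memory.setReg_arr, u2, e1] using i1.arr2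
      · intro j
        simp only [Memory.setReg_arr, u3, e1, Function.update_apply, i1.arr1]
        split_ifs <;> first | omega | simp [*]
      · simp [hreg, i2]
      · simp [hreg, i3, i1.reg0, Nat.add_mul]
  · rintro τ ⟨i1, i2, i3⟩
    exact ⟨by simp [i1.reg2, i2], i1⟩

/-- Write the adjacency matrix of the intersection graph. -/
def matrixProgram : Program :=
  .seq (.assign 4 (.lit 0)) <|
  .seq (.assign 6 (.lit 0)) <|
  .seq (.assign 10 (.lit 0)) <|
  .seq (.while (.minus (.reg 2) (.reg 4)) <|
    .seq (.assign 5 (.lit 0)) <|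
    .seq (.assign 7 (.lit 0)) <|
    .seq matrixRow <|
    .seq (.assign 4 (.plus (.reg 4) (.lit 1))) <|
    .assign 6 (.plus (.reg 6) (.reg 0))) <|
  .assign 0 (.reg 2)

theorem matrixProgram_runs {σ : Memory} (h : Table T k l σ) :
    Runs matrixProgram (l.length * (l.length * (22 * N + 37) + 20) + 12) σ fun τ =>
      HoldsOutput τ (rowGraph N l) := by
  refine .assign_seq (T₁ := l.length * (l.length * (22 * N + 37) + 20) + 10) (.assign_seq
    (T₁ := l.length * (l.length * (22 * N + 37) + 20) + 8) (.assign_seq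
    (T₁ := l.length * (l.length * (22 * N + 37) + 20) + 6) (.seq (T₂ := 2)
    (.while (T₁ := l.length * (22 * N + 37) + 16) l.length (fun x τ => MatrixState N l x 0 τ)
      ?_ ?_ (Q := MatrixState N l l.length 0) ?_ le_rfl) ?_ ?_)
    (by simp; omega)) (by simp; omega)) (by simp; omega)
  · refine ⟨?_, ?_, ?_, ?_, ?_, h.arr2, ?_⟩
    · simp [h.reg0]
    · simp [h.reg2]
    · simp
    · simp
    · simp
    · simp [h.arr1]
  · intro x hx τ i
    refine ⟨by simp [i.reg2, i.reg4]; omega, .assign_seq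
      (T₁ := l.length * (22 * N + 37) + 14) (.assign_seq
      (T₁ := l.length * (22 * N + 37) + 12) (.seq (T₂ := 8)
      (matrixRow_runs hx ⟨?_, ?_, ?_, ?_, ?_, i.arr2, i.arr1⟩ ?_ ?_) ?_ (by omega))
      (by simp; omega)) (by simp; omega)⟩
    · simp [i.reg0]
    · simp [i.reg2]
    · simp [i.reg4]
    · simp [i.reg6]
    · simp [i.reg10]
    · simp
    · simp
    · intro ρ j
      refine .assign_seq (T₁ := 4) (.assign (by simp) ⟨?_, ?_, ?_, ?_, ?_, j.arr2, ?_⟩) (by simp)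
      · simp [j.reg0]
      · simp [j.reg2]
      · simp [j.reg4]
      · simp [j.reg6, j.reg0, Nat.add_mul]
      · simp [j.reg10, Nat.add_mul]
      · intro i
        simp only [Memory.setReg_arr, j.arr1, Nat.add_mul, one_mul, add_zero]
  · intro τ i
    exact ⟨by simp [i.reg2, i.reg4], i⟩
  · intro τ i
    refine .assign (by simp) ⟨by simp [i.reg2], fun x hx => ?_⟩
    rw [Memory.setReg_arr, i.arr1, if_pos (by omega)]
  · simp [Nat.mul_add]
    omega

theorem rowsProgram_matrixProgram_runs (T : SimpleGraph (Fin N)) (k : ℕ) (hk : 0 < k)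
    (hl : (rows (natAdj T) N k N).length ≤ k * N) :
    Runs (.seq rowsProgram matrixProgram) (k ^ 2 * (300 * (N + 1) ^ 3)) (inputMemory T k)
      fun τ => HoldsOutput τ (rowGraph N (rows (natAdj T) N k N)) := by
  refine .seq (rowsProgram_runs T k) (fun τ h => matrixProgram_runs h) ?_
  generalize (rows (natAdj T) N k N).length = m at hl
  have hk2 : k ≤ k ^ 2 := Nat.le_self_pow (by omega) k
  have h1 : m * m ≤ k ^ 2 * N ^ 2 := by
    calc m * m ≤ (k * N) * (k * N) := Nat.mul_le_mul hl hl
      _ = _ := by ring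
  have h2 : m ≤ k ^ 2 * N := hl.trans (Nat.mul_le_mul_right _ hk2)
  have h3 : 1 ≤ k ^ 2 := by omega
  -- As k ≥ 1, every coefficient is absorbed into k². The remaining cubic in N is bounded
  -- coefficientwise by 300(N + 1)³.
  calc N * (N * (45 * N + 70) + 19 * k + 24) + 4 + (m * (m * (22 * N + 37) + 20) + 12)
      = 1 * (45 * N ^ 3 + 70 * N ^ 2 + 24 * N + 16) + k * (19 * N) +
        (m * m) * (22 * N + 37) + m * 20 := by ring
    _ ≤ k ^ 2 * (45 * N ^ 3 + 70 * N ^ 2 + 24 * N + 16) + k ^ 2 * (19 * N) +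
        (k ^ 2 * N ^ 2) * (22 * N + 37) + (k ^ 2 * N) * 20 := by gcongr
    _ = k ^ 2 * (67 * N ^ 3 + 107 * N ^ 2 + 63 * N + 16) := by ring
    _ ≤ k ^ 2 * (300 * (N + 1) ^ 3) := by
      refine Nat.mul_le_mul_left _ ?_
      rw [show 300 * (N + 1) ^ 3 = 300 * N ^ 3 + 900 * N ^ 2 + 900 * N + 300 by ring]
      omega

end RAM
-- Maximum cliques, facets and their stars.
section Cliques

variable {V : Type*} {G : SimpleGraph V} {k : ℕ}

theorem TJGraph_adj_iff [DecidableEq V] {C D : {C : Finset V // G.IsNClique k C}} :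
    (TJGraph k G).Adj C D ↔ (C.1 \ D.1).card = 1 := by
  have hcard : (C.1 \ D.1).card = (D.1 \ C.1).card := by
    have h1 := Finset.card_sdiff_add_card_inter C.1 D.1
    have h2 := Finset.card_sdiff_add_card_inter D.1 C.1
    rw [C.2.card_eq] at h1
    rw [D.2.card_eq, Finset.inter_comm] at h2
    omega
  constructor
  · rintro ⟨u, v, h, -⟩
    refine Finset.card_eq_one.2 ⟨u, ?_⟩
    exact_mod_cast h
  · intro h
    obtain ⟨u, hu⟩ := Finset.card_eq_one.1 h
    obtain ⟨v, hv⟩ := Finset.card_eq_one.1 (hcard ▸ h)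
    exact ⟨u, v, by exact_mod_cast hu, by exact_mod_cast hv⟩

/-- The set C ∩ D contains F, of size k - 1, but is a proper subset of C; so it equals F. -/
theorem card_sdiff_eq_one_of_subset [DecidableEq V] {C D F : Finset V} (hk : 0 < k)
    (hC : C.card = k) (hD : D.card = k) (hne : C ≠ D) (hF : F.card = k - 1) (hFC : F ⊆ C)
    (hFD : F ⊆ D) : (C \ D).card = 1 ∧ F = C ∩ D := by
  have h1 := Finset.card_sdiff_add_card_inter C D
  have h2 := Finset.card_le_card (Finset.subset_inter hFC hFD)
  have h3 : 0 < (C \ D).card := by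
    rw [Finset.card_pos, Finset.sdiff_nonempty]
    exact fun h => hne (Finset.eq_of_subset_of_card_le h (by omega))
  exact ⟨by omega, Finset.eq_of_subset_of_card_le (Finset.subset_inter hFC hFD) (by omega)⟩

/-- Three pairwise adjacent vertices of `TJ_ω(G)` have the same pairwise intersections. -/
theorem inter_subset_of_TJGraph_adj [DecidableEq V] [Finite V] (hk : k = G.cliqueNum)
    {A B D : {C : Finset V // G.IsNClique k C}} (hAB : (TJGraph k G).Adj A B)
    (hAD : (TJGraph k G).Adj A D) (hBD : (TJGraph k G).Adj B D) : A.1 ∩ B.1 ⊆ D.1 := by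
  intro w hw
  by_contra hwD
  obtain ⟨hwA, hwB⟩ := Finset.mem_inter.1 hw
  -- A \ D has one element and contains w, so D contains everything else of A; likewise for B.
  have hA : ∀ a ∈ A.1, a ≠ w → a ∈ D.1 := by
    intro a ha hne
    by_contra haD
    exact hne (Finset.card_le_one.1 (TJGraph_adj_iff.1 hAD).le a (by simp [ha, haD]) w
      (by simp [hwA, hwD]))
  have hB : ∀ b ∈ B.1, b ≠ w → b ∈ D.1 := by
    intro b hb hne
    by_contra hbD
    exact hne (Finset.card_le_one.1 (TJGraph_adj_iff.1 hBD).le b (by simp [hb, hbD]) w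
      (by simp [hwB, hwD]))
  obtain ⟨u, hu⟩ := Finset.card_eq_one.1 (TJGraph_adj_iff.1 hAB)
  obtain ⟨v, hv⟩ := Finset.card_eq_one.1 (TJGraph_adj_iff.1 hAB.symm)
  have hu' : u ∈ A.1 ∧ u ∉ B.1 := by rw [← Finset.mem_sdiff, hu]; simp
  have hv' : v ∈ B.1 ∧ v ∉ A.1 := by rw [← Finset.mem_sdiff, hv]; simp
  -- The vertex v is adjacent to A ∩ B inside the clique B, and to u inside D, which contains both u
  -- and v. This (k+1)-clique contradicts maximality.
  have hcl : G.IsNClique (k + 1) (insert v A.1) := by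
    refine A.2.insert fun a ha => ?_
    by_cases haB : a ∈ B.1
    · exact B.2.isClique hv'.1 haB (by rintro rfl; exact hv'.2 ha)
    · obtain rfl : a = u := by
        have : a ∈ A.1 \ B.1 := by simp [ha, haB]
        simpa [hu] using this
      refine D.2.isClique (hB v hv'.1 ?_) (hA a ha ?_) ?_
      · rintro rfl; exact hv'.2 hwA
      · rintro rfl; exact haB hwB
      · rintro rfl; exact hv'.2 ha
  have := hcl.isClique.card_le_cliqueNum
  rw [hcl.card_eq] at this
  omega

/-- Since the exchanged vertices are adjacent, F ∪ F' is a k-clique. Conversely, distinct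
(k-1)-subsets of a k-clique differ by one exchange, and the exchanged vertices are adjacent within
that clique. -/
theorem TSGraph_adj_iff (hk : 0 < k) {F F' : {C : Finset V // G.IsNClique (k - 1) C}} :
    (TSGraph (k - 1) G).Adj F F' ↔
      F ≠ F' ∧ ∃ C, G.IsNClique k C ∧ F.1 ⊆ C ∧ F'.1 ⊆ C := by
  classical
  constructor
  · intro h
    refine ⟨h.ne, ?_⟩
    obtain ⟨u, v, hu, hv, huv⟩ := h
    have hu : F.1 \ F'.1 = {u} := by exact_mod_cast hu
    have hv : F'.1 \ F.1 = {v} := by exact_mod_cast hv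
    have hv' : v ∈ F'.1 ∧ v ∉ F.1 := by rw [← Finset.mem_sdiff, hv]; simp
    refine ⟨insert v F.1, ?_, Finset.subset_insert _ _, fun w hw => ?_⟩
    · have := F.2.insert (a := v) fun a ha => ?_
      · rwa [Nat.sub_add_cancel hk] at this
      · by_cases haF : a ∈ F'.1
        · exact F'.2.isClique hv'.1 haF (by rintro rfl; exact hv'.2 ha)
        · obtain rfl : a = u := by
            have : a ∈ F.1 \ F'.1 := by simp [ha, haF]
            simpa [hu] using this
          exact huv.symm
    · by_cases hwF : w ∈ F.1
      · exact Finset.mem_insert_of_mem hwF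
      · have : w ∈ F'.1 \ F.1 := by simp [hw, hwF]
        rw [hv, Finset.mem_singleton] at this
        exact this ▸ Finset.mem_insert_self _ _
  · rintro ⟨hne, C, hC, hF, hF'⟩
    have key : ∀ A B : {C : Finset V // G.IsNClique (k - 1) C}, A ≠ B → A.1 ⊆ C → B.1 ⊆ C →
        ∃ u, A.1 \ B.1 = {u} := by
      intro A B hAB hA hB
      rw [← Finset.card_eq_one]
      have h1 : (A.1 \ B.1).card ≤ (C \ B.1).card :=
        Finset.card_le_card (Finset.sdiff_subset_sdiff hA le_rfl)
      rw [Finset.card_sdiff_of_subset hB, hC.card_eq, B.2.card_eq] at h1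
      have h2 : 0 < (A.1 \ B.1).card := by
        rw [Finset.card_pos, Finset.sdiff_nonempty]
        exact fun h => hAB (Subtype.ext (Finset.eq_of_subset_of_card_le h
          (by rw [A.2.card_eq, B.2.card_eq])))
      omega
    obtain ⟨u, hu⟩ := key F F' hne hF hF'
    obtain ⟨v, hv⟩ := key F' F hne.symm hF' hF
    have hu' : u ∈ F.1 ∧ u ∉ F'.1 := by rw [← Finset.mem_sdiff, hu]; simp
    have hv' : v ∈ F'.1 ∧ v ∉ F.1 := by rw [← Finset.mem_sdiff, hv]; simp
    exact ⟨u, v, by exact_mod_cast hu, by exact_mod_cast hv,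
      hC.isClique (hF hu'.1) (hF' hv'.1) (by rintro rfl; exact hu'.2 hv'.1)⟩

/-- The cliques of size `k - 1` that are contained in a clique of size `k`. -/
abbrev Facet (k : ℕ) (G : SimpleGraph V) : Type _ :=
  {F : {C : Finset V // G.IsNClique (k - 1) C} // ∃ C, G.IsNClique k C ∧ F.1 ⊆ C}

variable {N : ℕ} {T : SimpleGraph (Fin N)}

open Classical in
/-- The vertices of `T` whose cliques contain the facet `F`. -/
noncomputable def facetStar (φ : T ≃g TJGraph k G) (F : Facet k G) : Finset ℕ :=
  (Finset.range N).filter fun E => ∃ h : E < N, F.1.1 ⊆ (φ ⟨E, h⟩).1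

theorem mem_facetStar {φ : T ≃g TJGraph k G} {F : Facet k G} {E : ℕ} :
    E ∈ facetStar φ F ↔ ∃ h : E < N, F.1.1 ⊆ (φ ⟨E, h⟩).1 := by
  simp only [facetStar, Finset.mem_filter, Finset.mem_range, and_iff_right_iff_imp]
  exact fun h => h.1

theorem exists_facet [DecidableEq V] {A B : {C : Finset V // G.IsNClique k C}}
    (h : (TJGraph k G).Adj A B) : ∃ F : Facet k G, F.1.1 = A.1 ∩ B.1 := by
  have h1 := Finset.card_sdiff_add_card_inter A.1 B.1
  rw [TJGraph_adj_iff.1 h, A.2.card_eq] at h1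
  refine ⟨⟨⟨A.1 ∩ B.1, ⟨?_, by omega⟩⟩, A.1, A.2, Finset.inter_subset_left⟩, rfl⟩
  exact A.2.isClique.subset (by simp)

/-- Points are the k-cliques and blocks the facets. Maximality of k enters only in `triangle`; the
other axioms count subsets of size k - 1. -/
theorem isGeometry_facetStar [Finite V] (hk : 0 < k) (hω : k = G.cliqueNum)
    (φ : T ≃g TJGraph k G) : IsGeometry (natAdj T) N k (facetStar φ) where
  lt_of_mem F C hC := (mem_facetStar.1 hC).1
  nonempty := by
    rintro ⟨F, C, hC, hF⟩
    exact ⟨(φ.symm ⟨C, hC⟩).1, mem_facetStar.2 ⟨(φ.symm ⟨C, hC⟩).2, by simpa using hF⟩⟩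
  card_blocks C hC := by
    classical
    let A := φ ⟨C, hC⟩
    have e : {F : Facet k G // C ∈ facetStar φ F} ≃ (A.1.powersetCard (k - 1)) :=
      { toFun := fun F => ⟨F.1.1.1, Finset.mem_powersetCard.2
          ⟨(mem_facetStar.1 F.2).2, F.1.1.2.card_eq⟩⟩
        invFun := fun s =>
          have hs := Finset.mem_powersetCard.1 s.2
          ⟨⟨⟨s.1, A.2.isClique.subset hs.1, hs.2⟩, A.1, A.2, hs.1⟩,
            mem_facetStar.2 ⟨hC, hs.1⟩⟩
        left_inv := fun _ => rfl
        right_inv := fun _ => rfl }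
    rw [Nat.card_congr e, Nat.card_eq_fintype_card, Fintype.card_coe, Finset.card_powersetCard,
      A.2.card_eq]
    obtain ⟨n, rfl⟩ := Nat.exists_eq_add_of_lt hk
    simp
  unique F F' C D hCD h1 h2 h3 h4 := by
    classical
    obtain ⟨hC, h1⟩ := mem_facetStar.1 h1
    obtain ⟨hD, h2⟩ := mem_facetStar.1 h2
    have hne : (φ ⟨C, hC⟩).1 ≠ (φ ⟨D, hD⟩).1 := by
      simpa [Subtype.val_inj] using hCD
    have e1 := card_sdiff_eq_one_of_subset hk (φ ⟨C, hC⟩).2.card_eq (φ ⟨D, hD⟩).2.card_eq hne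
      F.1.2.card_eq h1 h2
    have e2 := card_sdiff_eq_one_of_subset hk (φ ⟨C, hC⟩).2.card_eq (φ ⟨D, hD⟩).2.card_eq hne
      F'.1.2.card_eq (mem_facetStar.1 h3).2 (mem_facetStar.1 h4).2
    exact Subtype.ext (Subtype.ext (e1.2.trans e2.2.symm))
  rel_iff C D := by
    classical
    constructor
    · rintro ⟨hC, hD, h⟩
      refine ⟨fun h0 => h.ne (Fin.ext h0), ?_⟩
      obtain ⟨F, hF⟩ := exists_facet (φ.map_adj_iff.2 h)
      exact ⟨F, mem_facetStar.2 ⟨hC, hF ▸ Finset.inter_subset_left⟩,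
        mem_facetStar.2 ⟨hD, hF ▸ Finset.inter_subset_right⟩⟩
    · rintro ⟨hCD, F, h1, h2⟩
      obtain ⟨hC, h1⟩ := mem_facetStar.1 h1
      obtain ⟨hD, h2⟩ := mem_facetStar.1 h2
      have hne : (φ ⟨C, hC⟩).1 ≠ (φ ⟨D, hD⟩).1 := by
        simpa [Subtype.val_inj] using hCD
      refine ⟨hC, hD, φ.map_adj_iff.1 (TJGraph_adj_iff.2 ?_)⟩
      exact (card_sdiff_eq_one_of_subset hk (φ ⟨C, hC⟩).2.card_eq (φ ⟨D, hD⟩).2.card_eq hne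
        F.1.2.card_eq h1 h2).1
  triangle := by
    classical
    rintro C D E ⟨hC, hD, hCD⟩ ⟨_, hE, hCE⟩ ⟨_, _, hDE⟩
    obtain ⟨F, hF⟩ := exists_facet (φ.map_adj_iff.2 hCD)
    exact ⟨F, mem_facetStar.2 ⟨hC, hF ▸ Finset.inter_subset_left⟩,
      mem_facetStar.2 ⟨hD, hF ▸ Finset.inter_subset_right⟩,
      mem_facetStar.2 ⟨hE, hF ▸ inter_subset_of_TJGraph_adj hω (φ.map_adj_iff.2 hCD)
        (φ.map_adj_iff.2 hCE) (φ.map_adj_iff.2 hDE)⟩⟩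

/-- A k-clique containing two facets is a common element of their stars, so adjacency of facets is
intersection of rows; the c isolated vertices are the non-facets. -/
theorem exists_iso_rowGraph_sum [Finite V] (hk : 0 < k) (φ : T ≃g TJGraph k G)
    {l : List (Finset ℕ)} (e : Facet k G ≃ Fin l.length)
    (he : ∀ F, l.get (e F) = facetStar φ F) :
    ∃ c : ℕ, Nonempty (TSGraph (k - 1) G ≃g rowGraph N l ⊕g (⊥ : SimpleGraph (Fin c))) := by
  classical
  let P : {C : Finset V // G.IsNClique (k - 1) C} → Prop :=
    fun F => ∃ C, G.IsNClique k C ∧ F.1 ⊆ C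
  obtain ⟨c, ⟨e'⟩⟩ := Finite.exists_equiv_fin {F // ¬ P F}
  let f := (Equiv.sumCompl P).symm.trans (Equiv.sumCongr e e')
  have f_pos : ∀ F (h : P F), f F = .inl (e ⟨F, h⟩) := fun F h => by
    simp [f, Equiv.sumCompl_symm_apply_of_pos h]
  have f_neg : ∀ F (h : ¬ P F), f F = .inr (e' ⟨F, h⟩) := fun F h => by
    simp [f, Equiv.sumCompl_symm_apply_of_neg h]
  refine ⟨c, ⟨⟨f, fun {F F'} => ?_⟩⟩⟩
  rw [TSGraph_adj_iff hk]
  by_cases hF : P F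
  · by_cases hF' : P F'
    · rw [f_pos F hF, f_pos F' hF']
      simp only [SimpleGraph.sum_adj, rowGraph, he, mem_facetStar, ne_eq, EmbeddingLike.apply_eq_iff_eq,
        Subtype.mk.injEq]
      refine and_congr_right fun _ => ?_
      constructor
      · rintro ⟨E, hE, ⟨_, h1⟩, ⟨_, h2⟩⟩
        exact ⟨_, (φ ⟨E, hE⟩).2, h1, h2⟩
      · rintro ⟨C, hC, h1, h2⟩
        exact ⟨(φ.symm ⟨C, hC⟩).1, (φ.symm ⟨C, hC⟩).2, ⟨(φ.symm ⟨C, hC⟩).2, by simpa using h1⟩,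
          ⟨(φ.symm ⟨C, hC⟩).2, by simpa using h2⟩⟩
    · rw [f_pos F hF, f_neg F' hF']
      refine iff_of_false (by simp) ?_
      rintro ⟨-, C, hC, -, h⟩
      exact hF' ⟨C, hC, h⟩
  · refine iff_of_false ?_ ?_
    · rw [f_neg F hF]
      cases f F' <;> simp
    · rintro ⟨-, C, hC, h, -⟩
      exact hF ⟨C, hC, h⟩

end Cliques

theorem mainTheorem6 :
    ∃ (P : RAM.Program) (p : Polynomial ℕ),
      ∀ (V : Type*) [Finite V] [Nonempty V] (G : SimpleGraph V) (k : ℕ), k = G.cliqueNum →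
        ∀ (N : ℕ) (T : SimpleGraph (Fin N)), Nonempty (T ≃g TJGraph k G) →
          ∃ (σ : RAM.Memory) (t : ℕ) (m : ℕ) (H : SimpleGraph (Fin m)),
            RAM.Exec P (RAM.inputMemory T k) σ t ∧
            t ≤ k ^ 2 * p.eval N ∧
            RAM.HoldsOutput σ H ∧
            ∃ c : ℕ, Nonempty (TSGraph (k - 1) G ≃g H ⊕g (⊥ : SimpleGraph (Fin c))) := by
  refine ⟨.seq RAM.rowsProgram RAM.matrixProgram, 300 * (Polynomial.X + 1) ^ 3, ?_⟩
  rintro V _ _ G k hω N T ⟨φ⟩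
  -- A single vertex is a clique, so k ≥ 1 and k - 1 is a true predecessor.
  have hk : 0 < k := by
    obtain ⟨v⟩ := ‹Nonempty V›
    have h := SimpleGraph.IsClique.card_le_cliqueNum (G := G) (t := {v}) (tc := by simp)
    rw [Finset.card_singleton] at h
    omega
  have hgeo := isGeometry_facetStar hk hω φ
  obtain ⟨e, he⟩ := hgeo.exists_equiv
  have hlen := length_rows_le (fun C hC => hgeo.numFirst_le hC) N le_rfl
  obtain ⟨σ, t, h1, h2, h3⟩ := RAM.rowsProgram_matrixProgram_runs T k hk hlen
  exact ⟨σ, t, _, _, h1, by simpa using h2, h3, exists_iso_rowGraph_sum hk φ e he⟩
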